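/- A t-norm is a map $T:[0,1]^2\to[0,1]$ that is commutative, associative, nondecreasing in each argument and satisfies $T(x,1)=x$; a t-conorm is a map $S:[0,1]^2\to[0,1]$ that is commutative, associative, nondecreasing in each argument and satisfies $S(x,0)=x$; a negation is a nonincreasing map $N:[0,1]\to[0,1]$ with $N(0)=1$ and $N(1)=0$. Let $M$ be a natural number. Let $\mathbf S_1$ be the set of formulas built from the variables $A_1,\dots,A_M$ with the connectives $\vee,\wedge,{}'$ (or, and, not), let $\mathbf V_2$ be the set of elementary sentences "$\mathrm{Tr}(B)=b$" with $B\in\mathbf S_1$ and $b\in[0,1]$, and let $\mathbf S_2$ be the set of formulas built from the elements of $\mathbf V_2$ with the connectives $\vee,\wedge,{}'$. Suppose $\vee,\wedge,{}'$ are implemented numerically, at both levels, by a continuous t-conorm $S$, a continuous t-norm $T$ and a continuous negation $N$ respectively. For $x=(x_1,\dots,x_M)\in[0,1]^M$ define truth values by $\mathrm{Tr}(A_m)=x_m$; by $\mathrm{Tr}(P\vee Q)=S(\mathrm{Tr}(P),\mathrm{Tr}(Q))$, $\mathrm{Tr}(P\wedge Q)=T(\mathrm{Tr}(P),\mathrm{Tr}(Q))$,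 $\mathrm{Tr}(P')=N(\mathrm{Tr}(P))$ on $\mathbf S_1$ and on $\mathbf S_2$; and by $\mathrm{Tr}(\text{"}\mathrm{Tr}(B)=b\text{"})=1-|\mathrm{Tr}(B)-b|$ on $\mathbf V_2$. For $D\in\mathbf S_2$ let $f_D:[0,1]^M\to[0,1]$ be the function that sends $x$ to the resulting value $\mathrm{Tr}(D)$. Then, for every choice of $D_1,\dots,D_M\in\mathbf S_2$ (where $A_m$ is taken to say $D_m$), the system of truth value equations $$x_m=f_{D_m}(x_1,\dots,x_M),\qquad m=1,\dots,M,$$ has at least one solution $\overline x\in[0,1]^M$, i.e. there is a consistent fuzzy truth value assignment. -/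

import Mathlib

namespace FuzzyTruth

/-- Truth values: the real unit interval `[0,1]`. -/
abbrev TruthValue : Type := unitInterval

/-- Logical formulas built from elementary sentences in `V` with "or", "and", "not". -/
inductive Formula (V : Type) : Type where
  | elem (v : V) : Formula V
  | disj (P Q : Formula V) : Formula V
  | conj (P Q : Formula V) : Formula V
  | neg (P : Formula V) : Formula V

/-- First-level sentences: formulas in the variables `A_1, ..., A_M`. -/
abbrev FirstLevel (M : ℕ) : Type := Formula (Fin M)

/-- Second-level elementary sentences "Tr(B) = b", where `B` is a first-level sentence
and `b ∈ [0,1]`. -/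
structure ElemAssessment (M : ℕ) : Type where
  /-- the first-level sentence `B` spoken about -/
  sentence : FirstLevel M
  /-- the truth value `b` that is claimed for `B` -/
  value : TruthValue

/-- Second-level sentences (truth value assessments): formulas in the second-level
elementary sentences. -/
abbrev SecondLevel (M : ℕ) : Type := Formula (ElemAssessment M)

/-- Triangular norms on `[0,1]`. -/
structure IsTNorm (T : TruthValue → TruthValue → TruthValue) : Prop where
  comm : ∀ x y, T x y = T y x
  assoc : ∀ x y z, T (T x y) z = T x (T y z)
  mono : ∀ x y z, y ≤ z → T x y ≤ T x z
  unit : ∀ x, T x 1 = x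

/-- Triangular conorms on `[0,1]`. -/
structure IsTConorm (S : TruthValue → TruthValue → TruthValue) : Prop where
  comm : ∀ x y, S x y = S y x
  assoc : ∀ x y z, S (S x y) z = S x (S y z)
  mono : ∀ x y z, y ≤ z → S x y ≤ S x z
  unit : ∀ x, S x 0 = x

/-- Negations on `[0,1]` (not required to be strict or involutive). -/
structure IsNegation (N : TruthValue → TruthValue) : Prop where
  anti : ∀ x y, x ≤ y → N y ≤ N x
  zero : N 0 = 1
  one : N 1 = 0

/-- A numerical implementation of the three logical operators. -/
structure Implementation : Type where
  /-- numerical "or" -/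
  or' : TruthValue → TruthValue → TruthValue
  /-- numerical "and" -/
  and' : TruthValue → TruthValue → TruthValue
  /-- numerical "not" -/
  not' : TruthValue → TruthValue

/-- The operators are a continuous t-conorm, a continuous t-norm and a continuous negation
(continuity of the binary operators is joint continuity on `[0,1] × [0,1]`). -/
structure Implementation.IsContinuousFuzzy (I : Implementation) : Prop where
  tconorm : IsTConorm I.or'
  tnorm : IsTNorm I.and'
  negation : IsNegation I.not'
  continuous_or : Continuous fun p : TruthValue × TruthValue => I.or' p.1 p.2
  continuous_and : Continuous fun p : TruthValue × TruthValue => I.and' p.1 p.2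
  continuous_not : Continuous I.not'

/-- Extension of a truth value assignment from elementary sentences to formulas. -/
def Formula.eval {V : Type} (I : Implementation) (t : V → TruthValue) :
    Formula V → TruthValue
  | .elem v => t v
  | .disj P Q => I.or' (P.eval I t) (Q.eval I t)
  | .conj P Q => I.and' (P.eval I t) (Q.eval I t)
  | .neg P => I.not' (P.eval I t)

/-- The number `1 - |y - b|`, which lies in `[0,1]` when `y` and `b` do. -/
def agreement (y b : TruthValue) : TruthValue :=
  ⟨1 - |(y : ℝ) - (b : ℝ)|, by
    obtain ⟨y, hy0, hy1⟩ := y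
    obtain ⟨b, hb0, hb1⟩ := b
    have h : |y - b| ≤ 1 := abs_le.mpr ⟨by linarith, by linarith⟩
    exact ⟨by simpa using h, by simp⟩⟩

variable {M : ℕ}

/-- `Tr(B)` for a first-level sentence `B`, given `Tr(A_m) = x_m`. -/
def trFirst (I : Implementation) (x : Fin M → TruthValue) (B : FirstLevel M) : TruthValue :=
  B.eval I x

/-- `Tr("Tr(B) = b") = 1 - |Tr(B) - b|`, given `Tr(A_m) = x_m`. -/
def trElem (I : Implementation) (x : Fin M → TruthValue) (C : ElemAssessment M) : TruthValue :=
  agreement (trFirst I x C.sentence) C.value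

/-- `Tr(D) = f_D(x_1, ..., x_M)` for a second-level sentence `D`, given `Tr(A_m) = x_m`. -/
def trSecond (I : Implementation) (x : Fin M → TruthValue) (D : SecondLevel M) : TruthValue :=
  D.eval I (trElem I x)

/-- The map `f = (f_1, ..., f_M) : [0,1]^M → [0,1]^M` of the collection `D_1, ..., D_M`. -/
def truthMap (I : Implementation) (D : Fin M → SecondLevel M)
    (x : Fin M → TruthValue) : Fin M → TruthValue :=
  fun m => trSecond I x (D m)

end FuzzyTruth

/-! Every $f_D$ is built from continuous operations, so the truth map is a continuous self-map of
the cube and Brouwer's theorem applies (`exists_fixedPoint_of_continuous`). Brouwer follows from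
Kuhn's lemma, proved here by mod 2 cohomology. For labels $\ell_0,\dots,\ell_{n-1}$ on a grid, sum
the cup product of the coboundaries $\delta\ell_j$ over the Kuhn triangulation. Changing one label
away from its two faces alters this cochain by the coboundary of a cochain vanishing on the
boundary, so by Stokes (`sum_faces_eq_zero`) the sum is unchanged. For the labels $[x_j\ge k]$
exactly one simplex counts, so the sum is always 1 and some simplex sees both values of every label.
-/

section

open Finset

/-! ### Cup products of mod 2 coboundaries -/

/-- The increasing enumeration of `ℕ` with the number `i` left out. -/
def skipIndex (i j : ℕ) : ℕ := if j < i then j else j + 1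

theorem skipIndex_zero (j : ℕ) : skipIndex 0 j = j + 1 := by simp [skipIndex]

theorem skipIndex_succ_zero (i : ℕ) : skipIndex (i + 1) 0 = 0 := by simp [skipIndex]

theorem skipIndex_succ_succ (i j : ℕ) : skipIndex (i + 1) (j + 1) = skipIndex i j + 1 := by
  simp only [skipIndex]; split_ifs <;> omega

/-- The cup product mod 2 of the coboundaries of `ℓ 0, …, ℓ (q - 1)`, evaluated on the
simplex with vertices `v 0, …, v q`. -/
def cupProd {X : Type*} (q : ℕ) (ℓ : ℕ → X → ZMod 2) (v : ℕ → X) : ZMod 2 :=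
  ∏ j ∈ range q, (ℓ j (v (j + 1)) + ℓ j (v j))

/-- The cup product mod 2 of the coboundaries of `ℓ 0, …, ℓ (p - 1)`, the function `h` and the
coboundaries of `ℓ (p + 1), …, ℓ (p + q)`, evaluated on the simplex `v 0, …, v (p + q)`. -/
def cupProdInsert {X : Type*} (p q : ℕ) (ℓ : ℕ → X → ZMod 2) (h : X → ZMod 2) (v : ℕ → X) :
    ZMod 2 :=
  cupProd p ℓ v * (h (v p) * cupProd q (fun j => ℓ (p + 1 + j)) (fun j => v (p + j)))

section
variable {X : Type*}

theorem cupProd_succ (q : ℕ) (ℓ : ℕ → X → ZMod 2) (v : ℕ → X) :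
    cupProd (q + 1) ℓ v =
      (ℓ 0 (v 1) + ℓ 0 (v 0)) * cupProd q (fun j => ℓ (j + 1)) (fun j => v (j + 1)) := by
  simp only [cupProd]
  rw [prod_range_succ', mul_comm]

theorem cupProdInsert_succ (p q : ℕ) (ℓ : ℕ → X → ZMod 2) (h : X → ZMod 2) (v : ℕ → X) :
    cupProdInsert (p + 1) q ℓ h v = (ℓ 0 (v 1) + ℓ 0 (v 0)) *
      cupProdInsert p q (fun j => ℓ (j + 1)) h (fun j => v (j + 1)) := by
  simp only [cupProdInsert, cupProd_succ, mul_assoc]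
  simp only [add_right_comm]

/-- Leibniz rule for a coboundary placed in front of a cochain `B`. -/
theorem sum_skipIndex_coboundary_mul (N : ℕ) (ℓ : X → ZMod 2) (B : (ℕ → X) → ZMod 2) (v : ℕ → X) :
    ∑ i ∈ range (N + 2), (ℓ (v (skipIndex i 1)) + ℓ (v (skipIndex i 0))) *
        B (fun j => v (skipIndex i (j + 1))) =
      (ℓ (v 1) + ℓ (v 0)) * ∑ i ∈ range (N + 1), B (fun j => v (skipIndex i j + 1)) := by
  rw [sum_range_succ', sum_range_succ', sum_range_succ', mul_add, mul_sum]
  simp only [skipIndex_zero, skipIndex_succ_zero, skipIndex_succ_succ,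
    show ∀ i, skipIndex i 1 = skipIndex i (0 + 1) from fun _ => rfl]
  rw [add_assoc, ← add_mul]
  congr 2
  have := CharTwo.add_self_eq_zero (ℓ (v 2))
  simp only [zero_add, one_add_one_eq_two]
  linear_combination this

/-- Each factor is closed, so the Leibniz rule makes the product a cocycle. -/
theorem sum_cupProd_skipIndex (q : ℕ) (ℓ : ℕ → X → ZMod 2) (v : ℕ → X) :
    ∑ i ∈ range (q + 2), cupProd q ℓ (fun j => v (skipIndex i j)) = 0 := by
  induction q generalizing ℓ v with
  | zero => simp only [cupProd, range_zero, prod_empty]; decide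
  | succ q ih =>
    simp only [cupProd_succ]
    rw [show q + 1 + 2 = (q + 1) + 2 from rfl, sum_skipIndex_coboundary_mul (q + 1) (ℓ 0)
      (fun u => cupProd q (fun j => ℓ (j + 1)) u), ih _ (fun j => v (j + 1)), mul_zero]

/-- All factors but $h$ are closed, so by Leibniz the coboundary only turns $h$ into $\delta h$, in
position $p$. -/
theorem sum_cupProdInsert_skipIndex (p q : ℕ) (ℓ : ℕ → X → ZMod 2) (h : X → ZMod 2) (v : ℕ → X) :
    ∑ i ∈ range (p + q + 2), cupProdInsert p q ℓ h (fun j => v (skipIndex i j)) =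
      cupProd (p + 1 + q) (Function.update ℓ p h) v := by
  induction p generalizing ℓ v with
  | zero =>
    -- Closedness of the tail: its sum over the faces that keep `v 0` equals its value on the face
    -- that omits `v 0`.
    have key := sum_cupProd_skipIndex q (fun j => ℓ (j + 1)) v
    rw [sum_range_succ'] at key
    simp only [cupProdInsert, zero_add, add_comm 1]
    rw [sum_range_succ', cupProd_succ]
    simp only [skipIndex_zero, skipIndex_succ_zero, cupProd, range_zero, prod_empty,
      one_mul, Function.update_self, zero_add, ne_eq, Nat.succ_ne_zero, not_false_eq_true,
      Function.update_of_ne, ← mul_sum] at key ⊢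
    have h2 : ((2 : ℕ) : ZMod 2) = 0 := by decide
    push_cast at h2
    linear_combination h (v 0) * key - h (v 0) * (∏ j ∈ range q,
      (ℓ (j + 1) (v (j + 1 + 1)) + ℓ (j + 1) (v (j + 1)))) * h2
  | succ p ih =>
    simp only [cupProdInsert_succ]
    rw [show p + 1 + q + 2 = (p + q + 1) + 2 by ring,
      sum_skipIndex_coboundary_mul _ (ℓ 0) (fun u => cupProdInsert p q (fun j => ℓ (j + 1)) h u),
      ih _ (fun j => v (j + 1)), show p + 1 + 1 + q = p + 1 + q + 1 by ring, cupProd_succ,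
      Function.update_of_ne (by omega)]
    congr 2
    funext j
    by_cases hj : j = p
    · subst hj; simp
    · rw [Function.update_of_ne hj, Function.update_of_ne (by omega)]

end

/-! ### Kuhn triangulation and Stokes' theorem -/

/-- The `j`-th vertex of the simplex of the Kuhn triangulation that lies in the unit cube with
lowest corner `b` and in which coordinate `c` is raised at step `ρ c`. -/
def kuhnVertex {n : ℕ} (b : Fin n → ℕ) (ρ : Equiv.Perm (Fin n)) (j : ℕ) (c : Fin n) : ℕ :=
  b c + if (ρ c : ℕ) < j then 1 else 0

/-- The lowest corners of the unit cubes in `[0,k]^n`. -/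
def gridCorners (n k : ℕ) : Finset (Fin n → ℕ) := Fintype.piFinset fun _ => range k

theorem mem_gridCorners {n k : ℕ} {b : Fin n → ℕ} : b ∈ gridCorners n k ↔ ∀ c, b c < k := by
  simp [gridCorners]

/-- Exchanging steps $i-1$ and $i$ moves only vertex $i$, which the face omits, so the terms cancel
in pairs. -/
theorem sum_inner_face {n : ℕ} (g : (ℕ → Fin n → ℕ) → ZMod 2)
    (b : Fin n → ℕ) (i : ℕ) (hi : 0 < i) (hin : i < n) :
    ∑ ρ : Equiv.Perm (Fin n), g (fun j => kuhnVertex b ρ (skipIndex i j)) = 0 := by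
  set s : Equiv.Perm (Fin n) := Equiv.swap ⟨i - 1, by omega⟩ ⟨i, hin⟩ with hs
  have hv : ∀ (ρ : Equiv.Perm (Fin n)) j,
      kuhnVertex b (s * ρ) (skipIndex i j) = kuhnVertex b ρ (skipIndex i j) := by
    intro ρ j
    funext c
    have hj : skipIndex i j ≠ i := by simp only [skipIndex]; split_ifs <;> omega
    have : ((s (ρ c) : Fin n) : ℕ) < skipIndex i j ↔ (ρ c : ℕ) < skipIndex i j := by
      rw [hs, Equiv.swap_apply_def]
      split_ifs with h1 h2
      · simp only [h1]; omega
      · simp only [h2]; omega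
      · rfl
    simp only [kuhnVertex, Equiv.Perm.mul_apply, this]
  refine sum_involution (fun ρ _ => s * ρ) ?_ ?_ (fun _ _ => mem_univ _) ?_
  · intro ρ _
    simp only [hv]
    exact CharTwo.add_self_eq_zero _
  · intro ρ _ _ h
    have h1 : s = 1 := by simpa using h
    have h2 := Equiv.swap_eq_one_iff.1 h1
    simp only [Fin.mk.injEq] at h2
    omega
  · intro ρ _
    rw [← mul_assoc, hs, Equiv.swap_mul_self, one_mul]

/-- Passage to the neighbour across the face opposite vertex 0: the coordinate raised first is
raised in the corner already, and its own step becomes the last. -/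
theorem kuhnVertex_rotate {n : ℕ} (b b' : Fin (n + 1) → ℕ) (ρ : Equiv.Perm (Fin (n + 1)))
    (hb : ∀ c, b' c = b c + if ρ c = 0 then 1 else 0) (j : ℕ) (hj : j < n + 1) :
    kuhnVertex b' ((finRotate (n + 1)).symm * ρ) j = kuhnVertex b ρ (j + 1) := by
  funext c
  simp only [kuhnVertex, hb, Equiv.Perm.mul_apply]
  obtain ⟨d, hd⟩ : ∃ d, ρ c = finRotate (n + 1) d := ⟨(finRotate (n + 1)).symm (ρ c), by simp⟩
  simp only [hd, Equiv.symm_apply_apply]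
  induction d using Fin.lastCases with
  | last =>
    simp
    omega
  | cast d =>
    have h1 : finRotate (n + 1) d.castSucc = d.succ := by
      rw [finRotate_apply, Fin.coeSucc_eq_succ]
    simp [h1, Fin.succ_ne_zero]

theorem sum_first_face_eq_sum_last_face {n k : ℕ} (g : (ℕ → Fin (n + 1) → ℕ) → ZMod 2)
    (hloc : ∀ u u', (∀ j < n + 1, u j = u' j) → g u = g u')
    (h0 : ∀ u c, (∀ j < n + 1, u j c = 0) → g u = 0)
    (hk : ∀ u c, (∀ j < n + 1, u j c = k) → g u = 0) :
    ∑ a ∈ gridCorners (n + 1) k ×ˢ (univ : Finset (Equiv.Perm (Fin (n + 1)))),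
        g (fun j => kuhnVertex a.1 a.2 (j + 1)) =
      ∑ a ∈ gridCorners (n + 1) k ×ˢ (univ : Finset (Equiv.Perm (Fin (n + 1)))),
        g (kuhnVertex a.1 a.2) := by
  -- If the neighbour's corner leaves the grid, the shared face lies in $x_c=k$, where $g$ vanishes.
  have hne : ∀ a : (Fin (n + 1) → ℕ) × Equiv.Perm (Fin (n + 1)),
      a ∈ gridCorners (n + 1) k ×ˢ (univ : Finset (Equiv.Perm (Fin (n + 1)))) →
      g (fun j => kuhnVertex a.1 a.2 (j + 1)) ≠ 0 → a.1 (a.2.symm 0) + 1 < k := by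
    rintro ⟨b, ρ⟩ ha hg
    by_contra hcon
    have hb := mem_gridCorners.1 (mem_product.1 ha).1 (ρ.symm 0)
    refine hg (hk _ (ρ.symm 0) fun j _ => ?_)
    simp only [kuhnVertex, Equiv.apply_symm_apply, Fin.val_zero] at hb hcon ⊢
    rw [if_pos (by omega)]
    omega
  refine sum_bij_ne_zero
    (fun a _ _ => (fun c => a.1 c + if a.2 c = 0 then 1 else 0, (finRotate (n + 1)).symm * a.2))
    ?_ ?_ ?_ ?_
  · rintro ⟨b, ρ⟩ ha hg
    have := hne _ ha hg
    have hb := mem_gridCorners.1 (mem_product.1 ha).1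
    refine mem_product.2 ⟨mem_gridCorners.2 fun c => ?_, mem_univ _⟩
    dsimp only at this hb ⊢
    split_ifs with hc
    · rw [← hc, Equiv.symm_apply_apply] at this; exact this
    · exact hb c
  · rintro ⟨b, ρ⟩ _ _ ⟨b', ρ'⟩ _ _ h
    simp only [Prod.mk.injEq, mul_right_inj] at h
    obtain ⟨h1, rfl⟩ := h
    simp only [Prod.mk.injEq, and_true]
    funext c
    exact Nat.add_right_cancel (congrFun h1 c)
  · rintro ⟨b, ρ⟩ ha hg
    have hb := mem_gridCorners.1 (mem_product.1 ha).1
    dsimp only at hb hg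
    -- Otherwise the coordinate raised last is 0 on the whole last face, where $g$ vanishes.
    have hpos : 0 < b (ρ.symm (Fin.last n)) := by
      by_contra hcon
      refine hg (h0 _ (ρ.symm (Fin.last n)) fun j hj => ?_)
      simp only [kuhnVertex, Equiv.apply_symm_apply, Fin.val_last]
      rw [if_neg (by omega)]
      omega
    set b₀ : Fin (n + 1) → ℕ := fun c => b c - if ρ c = Fin.last n then 1 else 0 with hb₀
    have hrot : ∀ c, (finRotate (n + 1) * ρ) c = 0 ↔ ρ c = Fin.last n := fun c => by
      rw [Equiv.Perm.mul_apply, ← finRotate_last, (finRotate (n + 1)).injective.eq_iff]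
    have hbb : ∀ c, b c = b₀ c + if (finRotate (n + 1) * ρ) c = 0 then 1 else 0 := by
      intro c
      simp only [hrot, hb₀]
      split_ifs with hc
      · rw [← hc, Equiv.symm_apply_apply] at hpos; omega
      · simp
    have hρ : (finRotate (n + 1)).symm * (finRotate (n + 1) * ρ) = ρ := by
      ext c; simp
    have hgg : g (fun j => kuhnVertex b₀ (finRotate (n + 1) * ρ) (j + 1)) = g (kuhnVertex b ρ) := by
      refine hloc _ _ fun j hj => ?_
      rw [← kuhnVertex_rotate b₀ b _ hbb j hj, hρ]
    refine ⟨(b₀, finRotate (n + 1) * ρ), mem_product.2 ⟨mem_gridCorners.2 fun c => ?_, mem_univ _⟩,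
      by rw [hgg]; exact hg, ?_⟩
    · exact lt_of_le_of_lt (Nat.sub_le _ _) (hb c)
    · refine Prod.ext (funext fun c => (hbb c).symm) hρ
  · rintro ⟨b, ρ⟩ _ _
    refine hloc _ _ fun j hj => ?_
    exact (kuhnVertex_rotate b _ ρ (fun c => rfl) j hj).symm

/-- Stokes' theorem mod 2 for a cochain that vanishes on the boundary of the grid `[0,k]^n`. -/
theorem sum_faces_eq_zero {n k : ℕ} (hn : 0 < n) (g : (ℕ → Fin n → ℕ) → ZMod 2)
    (hloc : ∀ u u', (∀ j < n, u j = u' j) → g u = g u')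
    (h0 : ∀ u c, (∀ j < n, u j c = 0) → g u = 0)
    (hk : ∀ u c, (∀ j < n, u j c = k) → g u = 0) :
    ∑ a ∈ gridCorners n k ×ˢ (univ : Finset (Equiv.Perm (Fin n))),
      ∑ i ∈ range (n + 1), g (fun j => kuhnVertex a.1 a.2 (skipIndex i j)) = 0 := by
  obtain ⟨n, rfl⟩ : ∃ m, n = m + 1 := ⟨n - 1, by omega⟩
  rw [sum_comm, sum_range_succ, sum_range_succ']
  rw [sum_eq_zero, zero_add]
  · simp only [skipIndex_zero]
    rw [sum_first_face_eq_sum_last_face g hloc h0 hk]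
    have : ∀ a : (Fin (n + 1) → ℕ) × Equiv.Perm (Fin (n + 1)),
        g (fun j => kuhnVertex a.1 a.2 (skipIndex (n + 1) j)) = g (kuhnVertex a.1 a.2) :=
      fun a => hloc _ _ fun j hj => by simp [skipIndex, hj]
    simp only [this]
    exact CharTwo.add_self_eq_zero _
  · intro i hi
    rw [sum_product]
    exact sum_eq_zero fun b _ => sum_inner_face g b (i + 1) (by omega)
      (by have := mem_range.1 hi; omega)

/-! ### Invariance of the Kuhn sum and Kuhn's lemma -/

theorem cupProd_update_add {X : Type*} {n m : ℕ} (hm : m < n) (ℓ : ℕ → X → ZMod 2)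
    (h h' : X → ZMod 2) (v : ℕ → X) :
    cupProd n (Function.update ℓ m (h + h')) v =
      cupProd n (Function.update ℓ m h) v + cupProd n (Function.update ℓ m h') v := by
  have key : ∀ f : X → ZMod 2, cupProd n (Function.update ℓ m f) v =
      (f (v (m + 1)) + f (v m)) * ∏ j ∈ (range n).erase m, (ℓ j (v (j + 1)) + ℓ j (v j)) := by
    intro f
    rw [cupProd, ← mul_prod_erase _ _ (mem_range.2 hm), Function.update_self]
    congr 1
    refine prod_congr rfl fun j hj => ?_
    rw [Function.update_of_ne (ne_of_mem_erase hj)]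
  rw [key, key, key, Pi.add_apply, Pi.add_apply]
  ring

/-- The number mod 2 of simplices of the Kuhn triangulation of `[0,k]^n`, weighted by the cup
product of the coboundaries of the labels. -/
def kuhnSum (n k : ℕ) (ℓ : ℕ → (Fin n → ℕ) → ZMod 2) : ZMod 2 :=
  ∑ a ∈ gridCorners n k ×ˢ (univ : Finset (Equiv.Perm (Fin n))),
    cupProd n ℓ (kuhnVertex a.1 a.2)

/-- The summand is the coboundary of the product with $h$ itself in position $m$. That cochain
vanishes on the boundary: on a face of direction $c\ne m$ the label $\ell_c$ is constant, and on
those of direction $m$ one has $h=0$. -/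
theorem kuhnSum_update_eq_zero {n k m : ℕ} (hm : m < n) (ℓ : ℕ → (Fin n → ℕ) → ZMod 2)
    (h : (Fin n → ℕ) → ZMod 2)
    (hℓ : ∀ c : Fin n, ∀ x y : Fin n → ℕ, x c = y c → x c = 0 ∨ x c = k → ℓ c x = ℓ c y)
    (hh : ∀ x : Fin n → ℕ, x ⟨m, hm⟩ = 0 ∨ x ⟨m, hm⟩ = k → h x = 0) :
    kuhnSum n k (Function.update ℓ m h) = 0 := by
  obtain ⟨q, rfl⟩ : ∃ q, n = m + 1 + q := ⟨n - (m + 1), by omega⟩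
  have hvan : ∀ e, e = 0 ∨ e = k → ∀ (u : ℕ → Fin (m + 1 + q) → ℕ) c,
      (∀ j < m + 1 + q, u j c = e) → cupProdInsert m q ℓ h u = 0 := by
    intro e he u c hu
    have hz : ∀ i j, i < m + 1 + q → j < m + 1 + q → ℓ c (u i) + ℓ c (u j) = 0 := by
      intro i j hi hj
      rw [hℓ c (u i) (u j) (by rw [hu i hi, hu j hj]) (by rw [hu i hi]; exact he)]
      exact CharTwo.add_self_eq_zero _
    obtain ⟨c, hc⟩ := c
    rcases lt_trichotomy c m with hcm | rfl | hcm
    · have : cupProd m ℓ u = 0 :=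
        prod_eq_zero (mem_range.2 hcm) (hz (c + 1) c (by omega) (by omega))
      rw [cupProdInsert, this, zero_mul]
    · rw [cupProdInsert, hh (u c) (by rw [hu c (by omega)]; exact he), zero_mul, mul_zero]
    · obtain ⟨d, rfl⟩ : ∃ d, c = m + 1 + d := ⟨c - (m + 1), by omega⟩
      have : cupProd q (fun j => ℓ (m + 1 + j)) (fun j => u (m + j)) = 0 :=
        prod_eq_zero (mem_range.2 (show d < q by omega))
          (hz (m + (d + 1)) (m + d) (by omega) (by omega))
      rw [cupProdInsert, this, mul_zero, mul_zero]
  have hloc : ∀ u u' : ℕ → Fin (m + 1 + q) → ℕ, (∀ j < m + 1 + q, u j = u' j) →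
      cupProdInsert m q ℓ h u = cupProdInsert m q ℓ h u' := by
    intro u u' huu
    rw [cupProdInsert, cupProdInsert, huu m (by omega)]
    congr 1
    · refine prod_congr rfl fun j hj => ?_
      have := mem_range.1 hj
      rw [huu j (by omega), huu (j + 1) (by omega)]
    · congr 1
      refine prod_congr rfl fun j hj => ?_
      have := mem_range.1 hj
      dsimp only
      rw [huu (m + j) (by omega), huu (m + (j + 1)) (by omega)]
  rw [← sum_faces_eq_zero (k := k) (by omega) (cupProdInsert m q ℓ h) hloc
    (hvan 0 (Or.inl rfl)) (hvan k (Or.inr rfl))]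
  refine sum_congr rfl fun a _ => ?_
  rw [← sum_cupProdInsert_skipIndex, show m + q + 2 = m + 1 + q + 1 by ring]

/-- The indicator function of the face on which coordinate `j` is at least `k`. -/
def farLabel (n k j : ℕ) (x : Fin n → ℕ) : ZMod 2 :=
  if ∃ h : j < n, k ≤ x ⟨j, h⟩ then 1 else 0

/-- Factor $j$ is nonzero only if coordinate $j$ reaches $k$ exactly at step $j$, which leaves the
top corner with the identity permutation. -/
theorem kuhnSum_farLabel {n k : ℕ} (hk : 0 < k) : kuhnSum n k (farLabel n k) = 1 := by
  rw [kuhnSum, sum_eq_single (fun _ => k - 1, 1)]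
  · refine prod_eq_one fun j hj => ?_
    have hj := mem_range.1 hj
    have h1 : k ≤ k - 1 + 1 := by omega
    have h2 : ¬ k ≤ k - 1 := by omega
    simp [farLabel, kuhnVertex, hj, h1, h2]
  · rintro ⟨b, ρ⟩ ha hne
    have hb := mem_gridCorners.1 (mem_product.1 ha).1
    by_contra hcup
    have hfac := fun j hj => prod_ne_zero_iff.1 hcup j hj
    have hj : ∀ c : Fin n, b c = k - 1 ∧ ρ c = c := by
      intro c
      have h1 := hfac c (mem_range.2 c.2)
      have h2 := hb c
      have h11 : (1 : ZMod 2) + 1 = 0 := by decide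
      simp only [farLabel, kuhnVertex, c.2, Fin.eta, exists_true_left] at h1 h2
      rw [Fin.ext_iff]
      split_ifs at h1 <;> first | (constructor <;> omega) | (exact absurd h11 h1)
    refine hne (Prod.ext (funext fun c => (hj c).1) (Equiv.ext fun c => (hj c).2))
  · intro h
    refine absurd (mem_product.2 ⟨mem_gridCorners.2 fun c => ?_, mem_univ _⟩) h
    exact Nat.sub_lt hk one_pos

theorem kuhnSum_eq_one {n k : ℕ} (hk : 0 < k) (ℓ : ℕ → (Fin n → ℕ) → ZMod 2)
    (h0 : ∀ (c : Fin n) x, x c = 0 → ℓ c x = 0) (h1 : ∀ (c : Fin n) x, x c = k → ℓ c x = 1) :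
    kuhnSum n k ℓ = 1 := by
  -- Interpolates between `ℓ` and `farLabel`, exchanging one label at a time.
  set L : ℕ → ℕ → (Fin n → ℕ) → ZMod 2 := fun m j => if j < m then farLabel n k j else ℓ j with hL
  have hf0 : ∀ (c : Fin n) x, x c = 0 → farLabel n k c x = 0 := by
    intro c x hx
    simp [farLabel, hx]
    omega
  have hf1 : ∀ (c : Fin n) x, x c = k → farLabel n k c x = 1 := by
    intro c x hx
    simp [farLabel, hx]
  have hL0 : ∀ m (c : Fin n) x, x c = 0 → L m c x = 0 := by
    intro m c x hx
    simp only [hL]; split_ifs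
    exacts [hf0 c x hx, h0 c x hx]
  have hL1 : ∀ m (c : Fin n) x, x c = k → L m c x = 1 := by
    intro m c x hx
    simp only [hL]; split_ifs
    exacts [hf1 c x hx, h1 c x hx]
  have hstep : ∀ m ≤ n, kuhnSum n k (L m) = kuhnSum n k ℓ := by
    intro m
    induction m with
    | zero => intro _; simp [hL]
    | succ m ih =>
      intro hm
      rw [← ih (by omega)]
      have e1 : L (m + 1) = Function.update (L m) m (farLabel n k m) := by
        funext j
        by_cases hj : j = m
        · subst hj; simp [hL]
        · rw [Function.update_of_ne hj]
          simp only [hL, show (j < m + 1 ↔ j < m) by omega]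
      have e2 : L m = Function.update (L m) m (ℓ m) := by
        refine (Function.update_eq_self_iff.2 ?_).symm
        simp [hL]
      have hz : kuhnSum n k (Function.update (L m) m (farLabel n k m + ℓ m)) = 0 := by
        refine kuhnSum_update_eq_zero hm _ _ ?_ ?_
        · rintro c x y hxy (hx | hx)
          · rw [hL0 m c x hx, hL0 m c y (hxy ▸ hx)]
          · rw [hL1 m c x hx, hL1 m c y (hxy ▸ hx)]
        · rintro x (hx | hx)
          · simp [hf0 ⟨m, hm⟩ x hx, h0 ⟨m, hm⟩ x hx]
          · rw [Pi.add_apply, hf1 ⟨m, hm⟩ x hx, h1 ⟨m, hm⟩ x hx]; decide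
      simp only [kuhnSum, cupProd_update_add hm, sum_add_distrib] at hz
      rw [← CharTwo.sub_eq_add, sub_eq_zero] at hz
      rw [e1, kuhnSum, hz]
      conv_rhs => rw [e2]
      rfl
  rw [← hstep n le_rfl, ← kuhnSum_farLabel (n := n) hk]
  refine sum_congr rfl fun a _ => prod_congr rfl fun j hj => ?_
  simp only [hL, if_pos (mem_range.1 hj)]

/-- **Kuhn's lemma**: if the labels `ℓ c` are `0` on the face `x c = 0` and `1` on the face
`x c = k` of the grid `[0,k]^n`, then some unit cube of the grid sees both values of every label. -/
theorem exists_cube_forall_label_eq {n k : ℕ} (hk : 0 < k) (ℓ : Fin n → (Fin n → ℕ) → ZMod 2)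
    (h0 : ∀ (c : Fin n) x, x c = 0 → ℓ c x = 0) (h1 : ∀ (c : Fin n) x, x c = k → ℓ c x = 1) :
    ∃ b : Fin n → ℕ, (∀ c, b c < k) ∧ ∀ c, ∀ e : ZMod 2,
      ∃ x : Fin n → ℕ, (∀ d, b d ≤ x d ∧ x d ≤ b d + 1) ∧ ℓ c x = e := by
  have hsum := kuhnSum_eq_one hk (fun j x => if h : j < n then ℓ ⟨j, h⟩ x else 0)
    (fun c x hx => by simp [h0 c x hx]) (fun c x hx => by simp [h1 c x hx])
  obtain ⟨⟨b, ρ⟩, ha, hne⟩ := exists_ne_zero_of_sum_ne_zero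
    (show kuhnSum n k _ ≠ 0 by rw [hsum]; exact one_ne_zero)
  refine ⟨b, mem_gridCorners.1 (mem_product.1 ha).1, fun c e => ?_⟩
  -- A nonzero factor means that label $c$ differs at vertices $c$ and $c+1$.
  have hc := prod_ne_zero_iff.1 hne c (mem_range.2 c.2)
  simp only [c.2, dite_true, Fin.eta] at hc
  have hv : ∀ j d, b d ≤ kuhnVertex b ρ j d ∧ kuhnVertex b ρ j d ≤ b d + 1 := by
    intro j d
    simp only [kuhnVertex]; split_ifs <;> omega
  have hz : ∀ s t e : ZMod 2, s + t ≠ 0 → s = e ∨ t = e := by decide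
  rcases hz _ _ e hc with h | h
  exacts [⟨_, hv _, h⟩, ⟨_, hv _, h⟩]

/-! ### Brouwer's theorem for the cube -/

/-- The point of the unit cube with grid coordinates `x` on the grid with mesh `1 / k`. -/
noncomputable def gridPoint {n : ℕ} (k : ℕ) (x : Fin n → ℕ) : Fin n → unitInterval :=
  fun c => Set.projIcc 0 1 zero_le_one ((x c : ℝ) / k)

theorem dist_gridPoint_le {n k : ℕ} (hk : 0 < k) (b x : Fin n → ℕ)
    (hx : ∀ d, b d ≤ x d ∧ x d ≤ b d + 1) :
    dist (gridPoint k x) (gridPoint k b) ≤ 1 / k := by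
  have hk' : (0 : ℝ) < k := Nat.cast_pos.2 hk
  refine (dist_pi_le_iff (by positivity)).2 fun c => ?_
  refine (Real.dist_eq _ _).le.trans ((Set.abs_projIcc_sub_projIcc zero_le_one).trans ?_)
  rw [← sub_div, abs_div, abs_of_pos hk']
  gcongr
  have h1 : (b c : ℝ) ≤ x c := Nat.cast_le.2 (hx c).1
  have h2 : (x c : ℝ) ≤ b c + 1 := by exact_mod_cast (hx c).2
  rw [abs_le]
  constructor <;> linarith

open Classical in
/-- Every continuous self-map of the unit cube almost fixes some point. -/
theorem exists_dist_map_le {n : ℕ} (f : (Fin n → unitInterval) → Fin n → unitInterval)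
    (hf : Continuous f) {ε : ℝ} (hε : 0 < ε) : ∃ x, dist (f x) x ≤ ε := by
  have huc := CompactSpace.uniformContinuous_of_continuous hf
  obtain ⟨δ, hδ, hfδ⟩ := Metric.uniformContinuous_iff.1 huc (ε / 2) (by positivity)
  obtain ⟨N, hN⟩ := exists_nat_one_div_lt (show 0 < min δ (ε / 2) by positivity)
  set k := N + 1 with hkdef
  have hk : 0 < k := Nat.succ_pos N
  have hkN : (1 : ℝ) / k < min δ (ε / 2) := by rw [hkdef]; exact_mod_cast hN
  -- Label 0 implies $f_c\ge x_c$ and label 1 implies $f_c\le x_c$; the prescribed values on the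
  -- faces respect this because $f$ maps into the cube.
  set ℓ : Fin n → (Fin n → ℕ) → ZMod 2 := fun c x =>
    if x c = 0 then 0 else if x c = k then 1 else
      if gridPoint k x c ≤ f (gridPoint k x) c then 0 else 1 with hℓ
  obtain ⟨b, -, hb⟩ := exists_cube_forall_label_eq hk ℓ
    (fun c x hx => by simp [hℓ, hx]) (fun c x hx => by simp [hℓ, hx, hk.ne'])
  have hle : ∀ c x, ℓ c x = 0 → gridPoint k x c ≤ f (gridPoint k x) c := by
    intro c x hx
    simp only [hℓ] at hx
    split_ifs at hx with h1 h2 h3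
    · simp only [gridPoint, h1, Nat.cast_zero, zero_div, Set.projIcc_left]
      exact unitInterval.nonneg'
    · exact absurd hx one_ne_zero
    · exact h3
    · exact absurd hx one_ne_zero
  have hge : ∀ c x, ℓ c x = 1 → f (gridPoint k x) c ≤ gridPoint k x c := by
    intro c x hx
    simp only [hℓ] at hx
    split_ifs at hx with h1 h2 h3
    · exact absurd hx zero_ne_one
    · have : (k : ℝ) / k = 1 := div_self (Nat.cast_ne_zero.2 hk.ne')
      simp only [gridPoint, h2, this, Set.projIcc_right]
      exact unitInterval.le_one'
    · exact absurd hx zero_ne_one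
    · exact (not_le.1 h3).le
  have hclose : ∀ x : Fin n → ℕ, (∀ d, b d ≤ x d ∧ x d ≤ b d + 1) → ∀ c,
      |(f (gridPoint k x) c : ℝ) - f (gridPoint k b) c| ≤ ε / 2 ∧
      |(gridPoint k x c : ℝ) - gridPoint k b c| ≤ ε / 2 := by
    intro x hx c
    have h1 := (dist_gridPoint_le hk b x hx).trans_lt hkN
    have h2 := hfδ (h1.trans_le (min_le_left _ _))
    exact ⟨(dist_le_pi_dist (f (gridPoint k x)) (f (gridPoint k b)) c).trans h2.le,
      (dist_le_pi_dist (gridPoint k x) (gridPoint k b) c).trans (h1.le.trans (min_le_right _ _))⟩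
  refine ⟨gridPoint k b, (dist_pi_le_iff hε.le).2 fun c => ?_⟩
  obtain ⟨y, hy, hy0⟩ := hb c 0
  obtain ⟨z, hz, hz1⟩ := hb c 1
  have h1 : (gridPoint k y c : ℝ) ≤ f (gridPoint k y) c := hle c y hy0
  have h2 : (f (gridPoint k z) c : ℝ) ≤ gridPoint k z c := hge c z hz1
  obtain ⟨h3, h4⟩ := hclose y hy c
  obtain ⟨h5, h6⟩ := hclose z hz c
  rw [abs_le] at h3 h4 h5 h6
  refine (Real.dist_eq _ _).le.trans (abs_le.2 ⟨?_, ?_⟩) <;> linarith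

/-- **Brouwer's fixed point theorem** for the unit cube. -/
theorem exists_fixedPoint_of_continuous {n : ℕ}
    (f : (Fin n → unitInterval) → Fin n → unitInterval) (hf : Continuous f) : ∃ x, f x = x := by
  -- The displacement attains its minimum, which cannot be positive since displacements get
  -- arbitrarily small.
  obtain ⟨x, -, hx⟩ := isCompact_univ.exists_isMinOn Set.univ_nonempty
    (hf.dist continuous_id).continuousOn
  refine ⟨x, ?_⟩
  by_contra hne
  have hpos : 0 < dist (f x) x := dist_pos.2 hne
  obtain ⟨y, hy⟩ := exists_dist_map_le f hf (half_pos hpos)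
  have : dist (f x) x ≤ dist (f y) y := hx (Set.mem_univ y)
  linarith

end

/-! ### Continuity of the truth map -/

namespace FuzzyTruth

theorem Formula.continuous_eval {V X : Type} [TopologicalSpace X] {I : Implementation}
    (hI : I.IsContinuousFuzzy) {t : X → V → TruthValue} (ht : ∀ v, Continuous fun x => t x v)
    (P : Formula V) : Continuous fun x => P.eval I (t x) := by
  induction P with
  | elem v => exact ht v
  | disj P Q hP hQ => exact hI.continuous_or.comp (hP.prodMk hQ)
  | conj P Q hP hQ => exact hI.continuous_and.comp (hP.prodMk hQ)
  | neg P hP => exact hI.continuous_not.comp hP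

theorem continuous_agreement (b : TruthValue) : Continuous fun y => agreement y b :=
  Continuous.subtype_mk (by fun_prop) _

theorem continuous_truthMap {M : ℕ} {I : Implementation} (hI : I.IsContinuousFuzzy)
    (D : Fin M → SecondLevel M) : Continuous (truthMap I D) :=
  continuous_pi fun m => Formula.continuous_eval hI
    (fun C => (continuous_agreement C.value).comp
      (Formula.continuous_eval hI (fun v => continuous_apply v) C.sentence)) (D m)

end FuzzyTruth

theorem proposition3 (M : ℕ) (I : FuzzyTruth.Implementation) (hI : I.IsContinuousFuzzy)
    (D : Fin M → FuzzyTruth.SecondLevel M) :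
    ∃ x : Fin M → FuzzyTruth.TruthValue, x = FuzzyTruth.truthMap I D x := by
  obtain ⟨x, hx⟩ := exists_fixedPoint_of_continuous _ (FuzzyTruth.continuous_truthMap hI D)
  exact ⟨x, hx.symm⟩
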